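/- For a square-free positive integer $n$, let $U_n=\operatorname{Spec}(\mathbb{Z}[1/n])$ and let $\pi_1(U_n)$ be its étale fundamental group, that is, the (profinite) Galois group over $\mathbb{Q}$ of the maximal Galois extension of $\mathbb{Q}$ that is unramified at all prime numbers not dividing $n$ (with no condition at infinity). Let $\pi_A(U_n)$ be the set of (isomorphism classes of) finite continuous quotients of $\pi_1(U_n)$; equivalently, the set of finite groups that occur as Galois groups of finite Galois extensions of $\mathbb{Q}$ unramified at all prime numbers not dividing $n$. **Proposition.** Let $n$ be a square-free positive integer. Then $\pi_A(U_n)$ determines $n$. More precisely, for every prime number $p$, $$p\mid n\quad\Longleftrightarrow\quad \mathbb{Z}/p^m\mathbb{Z}\in\pi_A(U_n)\ \text{ for every integer } m\ge 0 .$$ Consequently, if $n_1\neq n_2$ are square-free positive integers, then $\pi_A(U_{n_1})\neq\pi_A(U_{n_2})$. -/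

import Mathlib

open scoped NumberField

/-- A field `K` of algebraic numbers is unramified outside `n` if every prime number `p` not
dividing `n` is unramified in the ring of integers of `K`. There is no condition at infinity. -/
def UnramifiedOutside (n : ℕ) (K : Type*) [Field K] : Prop :=
  ∀ p : ℕ, p.Prime → ¬ p ∣ n → Algebra.IsUnramifiedIn (𝓞 K) (Ideal.span {(p : ℤ)})

/-- The maximal extension of `ℚ` (inside a fixed algebraic closure) unramified at the finite primes
not dividing `n`: the compositum of all finite Galois extensions of `ℚ` unramified outside `n`. -/
noncomputable def maxUnramifiedOutside (n : ℕ) : IntermediateField ℚ (AlgebraicClosure ℚ) :=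
  ⨆ K : {K : IntermediateField ℚ (AlgebraicClosure ℚ) //
    FiniteDimensional ℚ K ∧ IsGalois ℚ K ∧ UnramifiedOutside n K}, K.1

instance maxUnramifiedOutside_isGalois (n : ℕ) : IsGalois ℚ (maxUnramifiedOutside n) := by
  have : ∀ K : {K : IntermediateField ℚ (AlgebraicClosure ℚ) //
      FiniteDimensional ℚ K ∧ IsGalois ℚ K ∧ UnramifiedOutside n K}, Normal ℚ (K.1 : IntermediateField ℚ (AlgebraicClosure ℚ)) :=
    fun K => K.2.2.1.to_normal
  have : Normal ℚ (maxUnramifiedOutside n) :=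
    IntermediateField.normal_iSup (F := ℚ) (K := AlgebraicClosure ℚ) (h := this)
  exact ⟨⟩

/-- The étale fundamental group of `U_n = Spec ℤ[1/n]`, namely the Galois group over `ℚ` of the
maximal extension of `ℚ` unramified at the finite primes not dividing `n`; it carries the
Krull topology. -/
abbrev piOne (n : ℕ) : Type := Gal(maxUnramifiedOutside n/ℚ)

/-- The set `π_A(U_n)` of finite quotients of the profinite group `π₁(U_n)`: the finite groups `G`
for which there is a surjective homomorphism `π₁(U_n) → G` with open kernel (that is, continuous
for the discrete topology on `G`). -/
def piA (n : ℕ) : Set FiniteGrp.{0} :=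
  {G | ∃ f : piOne n →* G, Function.Surjective f ∧ IsOpen (f.ker : Set (piOne n))}

/-- The cyclic group `ℤ/kℤ`, `k ≠ 0`, as a finite (multiplicatively written) group. -/
def cyclicGrp (k : ℕ) [NeZero k] : FiniteGrp.{0} := FiniteGrp.of (Multiplicative (ZMod k))

/-!
If a prime `p` divides `n`, the cyclotomic fields of `p`-power level are unramified outside `n`, and
their Galois groups `(ℤ/p^k)ˣ` have all groups `ℤ/p^m` as quotients (`cyclicGrp_mem_piA`).

Conversely, suppose `p ∤ n` and let `L/ℚ` be a cyclic extension of degree `p ^ m > 1` unramified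
outside `n`. The proper subgroups of its Galois group all lie in a single subgroup `H` of index `p`.
If every inertia group were proper, the fixed field of `H` would be unramified at all primes,
contradicting Minkowski's theorem that `ℚ` has no nontrivial such extension. So `L` is totally ramified
at some prime `ℓ`, which must divide `n` (`NumberField.exists_inertia_eq_top`). Since `ℓ ≠ p`, the
ramification is tame: the inertia group acts faithfully on the line `Q/Q²` over the residue field
`𝔽_ℓ` of the prime `Q` above `ℓ`, whence `p ^ m ∣ ℓ - 1`
(`Ideal.pow_card_quotient_sub_one_eq_one`, `NumberField.prime_pow_dvd_sub_one_of_inertia_eq_top`).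
Thus `p ^ m < n`, and `ℤ/p^m` does not occur in `π_A(U_n)` once `p ^ m ≥ n`. No class field theory or
Kronecker–Weber theorem is needed.

The passage between groups in `π_A(U_n)` and number fields (`mem_piA_of_surjective`,
`exists_numberField_of_mem_piA`) rests on the fact that composita and subfields of extensions
unramified outside `n` are again unramified outside `n` (`UnramifiedOutside.of_iSup_eq_top`,
`UnramifiedOutside.of_algebra`). Finally, a square-free number is determined by its prime divisors.
-/

/-! ### Cyclic groups and cyclic quotients of abelian groups -/

/-- An element of order `d` in a finite abelian group gives a quotient that is cyclic of order `d`: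
under a (non-canonical) isomorphism of the group with its dual it becomes a character of order `d`,
whose image is the desired quotient. -/
theorem CommGroup.exists_surjective_multiplicative_zmod {A : Type*} [CommGroup A] [Finite A]
    (a : A) : ∃ f : A →* Multiplicative (ZMod (orderOf a)), Function.Surjective f := by
  obtain ⟨e⟩ := CommGroup.monoidHom_mulEquiv_of_hasEnoughRootsOfUnity A ℂ
  set χ : A →* ℂˣ := e.symm a with hχ
  have hord : orderOf χ = orderOf a := by rw [hχ, MulEquiv.orderOf_eq]
  have : Finite χ.range := Finite.of_surjective _ χ.rangeRestrict_surjective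
  have hcyc : IsCyclic χ.range := isCyclic_subgroup_units χ.range
  have hcard : Nat.card χ.range = orderOf a := by
    obtain ⟨g, hg⟩ := IsCyclic.exists_generator (α := χ.range)
    obtain ⟨x, rfl⟩ := χ.rangeRestrict_surjective g
    rw [← orderOf_eq_card_of_forall_mem_zpowers hg, ← Subgroup.orderOf_coe,
      MonoidHom.coe_rangeRestrict, ← hord]
    refine Nat.dvd_antisymm (orderOf_dvd_of_pow_eq_one ?_) (orderOf_dvd_of_pow_eq_one ?_)
    · rw [← MonoidHom.pow_apply, pow_orderOf_eq_one, MonoidHom.one_apply]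
    · ext y : 1
      obtain ⟨k, hk⟩ := Subgroup.mem_zpowers_iff.1 (hg ⟨χ y, y, rfl⟩)
      have hk' : χ x ^ k = χ y := congrArg Subtype.val hk
      rw [MonoidHom.pow_apply, ← hk', MonoidHom.one_apply, ← zpow_natCast, ← zpow_mul, mul_comm,
        zpow_mul, zpow_natCast, pow_orderOf_eq_one, one_zpow]
  let i : χ.range ≃* Multiplicative (ZMod (orderOf a)) :=
    mulEquivOfCyclicCardEq (hcard.trans (Nat.card_zmod _).symm)
  exact ⟨i.toMonoidHom.comp χ.rangeRestrict,
    i.surjective.comp χ.rangeRestrict_surjective⟩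

/-- `ℤ/p^m` is a quotient of `(ℤ/p^(m+2))ˣ`, because `1 + p²` has order `p^m` there. The exponent
`m + 2`, rather than `m + 1`, makes this uniform in `p`, including `p = 2`. -/
theorem ZMod.exists_units_pow_surjective {p : ℕ} (hp : p.Prime) (m : ℕ) :
    ∃ f : (ZMod (p ^ (m + 2)))ˣ →* Multiplicative (ZMod (p ^ m)), Function.Surjective f := by
  have : NeZero (p ^ (m + 2)) := ⟨pow_ne_zero _ hp.ne_zero⟩
  have h : orderOf (1 + (p : ZMod (p ^ (m + 2))) ^ 2 * ((1 : ℤ) : ZMod (p ^ (m + 2)))) = p ^ m :=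
    ZMod.orderOf_one_add_mul_prime_pow hp 2 two_ne_zero (by have := hp.two_le; omega) 1
      (by rw [← Nat.cast_one, Int.natCast_dvd_natCast]; exact hp.one_lt.ne' ∘ Nat.dvd_one.1) m
  have hu := isOfFinOrder_iff_pow_eq_one.2
    ⟨p ^ m, pow_pos hp.pos _, h ▸ pow_orderOf_eq_one _⟩
  rw [← h, ← hu.val_unit, orderOf_units]
  exact CommGroup.exists_surjective_multiplicative_zmod hu.unit

/-- A nontrivial cyclic `p`-group has a subgroup of index `p` that contains all proper subgroups. -/
theorem IsCyclic.exists_index_eq_prime_forall_le_or_eq_top {G : Type*} [Group G] [IsCyclic G]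
    {p m : ℕ} (hp : p.Prime) (hm : m ≠ 0) (hG : Nat.card G = p ^ m) :
    ∃ H : Subgroup G, H.index = p ∧ ∀ I : Subgroup G, I ≤ H ∨ I = ⊤ := by
  have : Finite G := Nat.finite_of_card_ne_zero (hG ▸ pow_ne_zero _ hp.ne_zero)
  obtain ⟨g, hg⟩ := IsCyclic.exists_generator (α := G)
  have hord : orderOf g = p ^ m := by rw [orderOf_eq_card_of_forall_mem_zpowers hg, hG]
  refine ⟨Subgroup.zpowers (g ^ p), ?_, fun I ↦ ?_⟩
  · have h := (Subgroup.zpowers (g ^ p)).card_mul_index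
    rw [Nat.card_zpowers, orderOf_pow_of_dvd hp.ne_zero (hord ▸ dvd_pow_self p hm), hord, hG] at h
    refine Nat.eq_of_mul_eq_mul_left (Nat.div_pos (Nat.le_of_dvd (pow_pos hp.pos _)
      (dvd_pow_self p hm)) hp.pos) (h.trans (Nat.div_mul_cancel (dvd_pow_self p hm)).symm)
  · by_cases hI : I ≤ Subgroup.zpowers (g ^ p)
    · exact .inl hI
    obtain ⟨x, hxI, hx⟩ := SetLike.not_le_iff_exists.1 hI
    obtain ⟨k, rfl⟩ := (mem_powers_iff_mem_zpowers (x := g)).2 (hg x)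
    have hpk : ¬ p ∣ k := by
      rintro ⟨j, rfl⟩
      exact hx (by simp [pow_mul])
    have hcop : k.Coprime (orderOf g) := by
      rw [hord]
      exact ((hp.coprime_iff_not_dvd.2 hpk).pow_left m).symm
    obtain ⟨j, hj⟩ := exists_pow_eq_self_of_coprime hcop
    have hgI : g ∈ I := hj ▸ I.pow_mem hxI j
    exact .inr (top_le_iff.1 fun y _ ↦ Subgroup.zpowers_le.2 hgI (hg y))

/-! ### Tame inertia -/

section Tame

variable {G O : Type*} [Group G] [CommRing O] [MulSemiringAction G O] {Q : Ideal O}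

/-- If `h` acts trivially on `O/Q` and on `Q/Q²`, then it acts trivially on every
`Q ^ k / Q ^ (k + 1)`. -/
theorem Ideal.smul_sub_mem_pow_succ {h : G} (h0 : ∀ x : O, h • x - x ∈ Q)
    (h1 : ∀ x ∈ Q, h • x - x ∈ Q ^ 2) (k : ℕ) : ∀ x ∈ Q ^ k, h • x - x ∈ Q ^ (k + 1) := by
  induction k with
  | zero => simpa using h0
  | succ k ih =>
    intro x hx
    rw [pow_succ] at hx
    refine Submodule.mul_induction_on hx (fun a ha b hb ↦ ?_) fun a b ha hb ↦ ?_
    · have hha : h • a ∈ Q ^ k := by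
        simpa using add_mem (Ideal.pow_le_pow_right k.le_succ (ih a ha)) ha
      have e : h • (a * b) - a * b = h • a * (h • b - b) + (h • a - a) * b := by
        rw [smul_mul']; ring
      change h • (a * b) - a * b ∈ _
      rw [e]
      refine add_mem ?_ ?_
      · rw [show k + 1 + 1 = k + 2 from rfl, pow_add]
        exact Ideal.mul_mem_mul hha (h1 b hb)
      · rw [pow_succ]
        exact Ideal.mul_mem_mul (ih a ha) hb
    · rw [smul_add, add_sub_add_comm]
      exact add_mem ha hb

/-- The wild inertia group has no nontrivial elements of order prime to the residue characteristic:
an automorphism `h` with `h ^ q = 1` that acts trivially on `O/Q` and on `Q/Q²` is trivial, provided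
that `q` can be cancelled modulo every power of `Q`. If `h` acts trivially modulo `Q ^ k`, then
`h ^ i • x - x ≡ i * (h • x - x)` modulo `Q ^ (k + 1)` for all `i`; the case `i = q` shows that `h`
acts trivially modulo `Q ^ (k + 1)`. -/
theorem Ideal.smul_eq_of_pow_eq_one [Q.IsPrime] [IsDomain O] [IsNoetherianRing O] {h : G}
    (h0 : ∀ x : O, h • x - x ∈ Q) (h1 : ∀ x ∈ Q, h • x - x ∈ Q ^ 2) {q : ℕ} (hq : h ^ q = 1)
    (hqQ : ∀ k, ∀ x, (q : O) * x ∈ Q ^ k → x ∈ Q ^ k) (x : O) : h • x = x := by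
  have key : ∀ k, h • x - x ∈ Q ^ k := by
    intro k
    induction k with
    | zero => simp
    | succ k ih =>
      have hd : ∀ i : ℕ, h ^ i • x - x - i * (h • x - x) ∈ Q ^ (k + 1) := by
        intro i
        induction i with
        | zero => simp
        | succ i hi =>
          have e : h ^ (i + 1) • x - x - (i + 1 : ℕ) * (h • x - x) =
            (h • (h ^ i • x - x) - (h ^ i • x - x)) +
              (h ^ i • x - x - i * (h • x - x)) := by
            rw [pow_succ', mul_smul, smul_sub]; push_cast; ring
          rw [e]
          refine add_mem (Ideal.smul_sub_mem_pow_succ h0 h1 k _ ?_) hi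
          have := add_mem (Ideal.pow_le_pow_right k.le_succ hi) (Ideal.mul_mem_left _ (i : O) ih)
          simpa using this
      have := hd q
      rw [hq, one_smul, sub_self, zero_sub, neg_mem_iff] at this
      exact hqQ _ _ this
  have hbot := Ideal.iInf_pow_eq_bot_of_isDomain Q Ideal.IsPrime.ne_top'
  rw [← sub_eq_zero, ← Ideal.mem_bot, ← hbot]
  exact Ideal.mem_iInf.2 key

theorem Ideal.smul_mem_pow_of_mem_inertia {g : G} (hg : g ∈ Q.inertia G) {k : ℕ} {x : O}
    (hx : x ∈ Q ^ k) : g • x ∈ Q ^ k :=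
  Ideal.le_comap_pow (K := Q) (MulSemiringAction.toRingHom G O g) k
    (Ideal.pow_right_mono (fun y hy ↦ by simpa using add_mem (hg y) hy) k hx)

/-- The tame inertia bound: an element of the inertia group at `Q` whose order is prime to the residue
characteristic has order dividing `|O/Q| - 1`. It acts on the line `Q/Q²` over the field `O/Q` by a
nonzero scalar `d`, so its power with exponent `|O/Q| - 1` acts trivially on `Q/Q²`. -/
theorem Ideal.pow_card_quotient_sub_one_eq_one [FaithfulSMul G O] [IsDedekindDomain O]
    [Q.IsMaximal] (hQ : Q ≠ ⊥) [Finite (O ⧸ Q)] {g : G} (hg : g ∈ Q.inertia G) {q : ℕ}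
    (hgq : g ^ q = 1) (hq : (q : O) ∉ Q) : g ^ (Nat.card (O ⧸ Q) - 1) = 1 := by
  have hlt : Q ^ 2 < Q := by
    simpa using Ideal.pow_right_strictAnti Q hQ Ideal.IsPrime.ne_top' one_lt_two
  obtain ⟨π, hπ, hπ2⟩ := SetLike.exists_of_lt hlt
  have hmem (g : G) (hg : g ∈ Q.inertia G) (x : O) (hx : x ∈ Q) : g • x ∈ Q := by
    simpa using add_mem (hg x) hx
  have hstep (x : O) (hx : x ∈ Q) : ∃ d, ∃ e ∈ Q ^ 2, π * d + e = x :=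
    Ideal.exists_mul_add_mem_pow_succ hQ (i := 1) π x (by simpa) hπ2 (by simpa)
  obtain ⟨d, e, he, hde⟩ := hstep (g • π) (hmem g hg π hπ)
  have hpow (i : ℕ) : g ^ i • π - d ^ i * π ∈ Q ^ 2 := by
    induction i with
    | zero => simp
    | succ i hi =>
      have e1 : g ^ (i + 1) • π - d ^ (i + 1) * π = g • (g ^ i • π - d ^ i * π) +
          (d ^ i * e + (g • d ^ i - d ^ i) * (g • π)) := by
        rw [pow_succ' g, mul_smul, smul_sub, smul_mul', ← hde]; ring
      rw [e1]
      refine add_mem (Ideal.smul_mem_pow_of_mem_inertia hg hi)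
        (add_mem (Ideal.mul_mem_left _ _ he) ?_)
      rw [sq]
      exact Ideal.mul_mem_mul (hg _) (hmem g hg π hπ)
  have hdQ : d ∉ Q := by
    intro hd
    refine hπ2 ?_
    have hgπ : g • π ∈ Q ^ 2 := by
      rw [← hde]
      exact add_mem (by rw [sq]; exact Ideal.mul_mem_mul hπ hd) he
    simpa using Ideal.smul_mem_pow_of_mem_inertia (inv_mem hg) hgπ
  let _ := Ideal.Quotient.field Q
  have := Fintype.ofFinite (O ⧸ Q)
  set N := Nat.card (O ⧸ Q) - 1 with hN
  have hdN : d ^ N - 1 ∈ Q := by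
    rw [← Ideal.Quotient.eq_zero_iff_mem, map_sub, map_pow, map_one, hN, Nat.card_eq_fintype_card,
      FiniteField.pow_card_sub_one_eq_one _ (by rwa [Ne, Ideal.Quotient.eq_zero_iff_mem]), sub_self]
  have hh : g ^ N ∈ Q.inertia G := pow_mem hg N
  have h1 (x : O) (hx : x ∈ Q) : g ^ N • x - x ∈ Q ^ 2 := by
    obtain ⟨c, f, hf, rfl⟩ := hstep x hx
    have e1 : g ^ N • (π * c + f) - (π * c + f) = (g ^ N • c) * (g ^ N • π - d ^ N * π) +
        (g ^ N • c) * ((d ^ N - 1) * π) + (g ^ N • c - c) * π + (g ^ N • f - f) := by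
      rw [smul_add, smul_mul']; ring
    rw [e1]
    refine add_mem (add_mem (add_mem ?_ ?_) ?_) ?_
    · exact Ideal.mul_mem_left _ _ (hpow N)
    · exact Ideal.mul_mem_left _ _ (by rw [sq]; exact Ideal.mul_mem_mul hdN hπ)
    · rw [sq]; exact Ideal.mul_mem_mul (hh c) hπ
    · exact sub_mem (Ideal.smul_mem_pow_of_mem_inertia hh hf) hf
  refine FaithfulSMul.eq_of_smul_eq_smul (α := O) fun x ↦ ?_
  rw [one_smul]
  exact Ideal.smul_eq_of_pow_eq_one hh h1 (q := q)
    (by rw [← pow_mul, mul_comm, pow_mul, hgq, one_pow])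
    (fun k x hx ↦ (Ideal.IsPrime.mul_mem_pow Q hx).resolve_left hq) x

end Tame

/-! ### Inertia groups in Galois number fields -/

theorem NumberField.card_inertia_eq_ramificationIdx {L : Type*} [Field L] [NumberField L]
    [IsGalois ℚ L] {ℓ : ℕ} (hℓ : ℓ.Prime) (P : Ideal (𝓞 L)) [P.IsPrime]
    [P.LiesOver (Ideal.span {(ℓ : ℤ)})] :
    Nat.card (P.inertia Gal(L/ℚ)) = P.ramificationIdx ℤ := by
  have := Fact.mk hℓ
  have : Finite (ℤ ⧸ Ideal.span {(ℓ : ℤ)}) :=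
    Ring.HasFiniteQuotients.finiteQuotient (by simpa using hℓ.ne_zero)
  rw [Ideal.card_inertia_eq_ramificationIdxIn (Ideal.span {(ℓ : ℤ)}) P,
    Ideal.ramificationIdxIn_eq_ramificationIdx _ P Gal(L/ℚ)]

/-- Being unramified outside `n` passes to subfields, and so also along isomorphisms. -/
theorem UnramifiedOutside.of_algebra {n : ℕ} {K F : Type*} [Field K] [Field F] [NumberField K]
    [NumberField F] [Algebra K F] (h : UnramifiedOutside n F) : UnramifiedOutside n K := by
  intro p hp hpn P _ _
  obtain ⟨Q, _, _⟩ := (inferInstance : Nonempty (P.primesOver (𝓞 F)))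
  have : Q.LiesOver (Ideal.span {(p : ℤ)}) := .trans Q P _
  have := h p hp hpn Q inferInstance inferInstance
  exact Algebra.IsUnramifiedAt.of_liesOver ℤ P Q

/-- A compositum of Galois extensions of `ℚ` unramified outside `n` is unramified outside `n`: an
element of an inertia group restricts to elements of the inertia groups of the given subfields,
which are trivial, so it fixes these subfields and hence their compositum. -/
theorem UnramifiedOutside.of_iSup_eq_top {n : ℕ} {F : Type*} [Field F] [NumberField F]
    [IsGalois ℚ F] {ι : Type*} (K : ι → IntermediateField ℚ F) [∀ i, IsGalois ℚ (K i)]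
    (hK : ∀ i, UnramifiedOutside n (K i)) (htop : ⨆ i, K i = ⊤) : UnramifiedOutside n F := by
  intro p hp hpn Q _ _
  rw [← Ideal.ramificationIdx_eq_one_iff, ← NumberField.card_inertia_eq_ramificationIdx hp Q,
    Subgroup.card_eq_one, eq_bot_iff]
  intro σ hσ
  have hfix (i : ι) : K i ≤ IntermediateField.fixedField (Subgroup.zpowers σ) := by
    set P := Q.under (𝓞 (K i))
    have hlo : P.LiesOver (Ideal.span {(p : ℤ)}) := Ideal.LiesOver.tower_bot Q P _
    have hP := hK i p hp hpn P inferInstance inferInstance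
    rw [← Ideal.ramificationIdx_eq_one_iff, ← NumberField.card_inertia_eq_ramificationIdx hp P,
      Subgroup.card_eq_one] at hP
    have hres : σ.restrictNormal (K i) ∈ P.inertia Gal(K i/ℚ) := by
      intro x
      change algebraMap (𝓞 (K i)) (𝓞 F) _ ∈ Q
      have hx : algebraMap (𝓞 (K i)) (𝓞 F) (σ.restrictNormal (K i) • x) =
          σ • algebraMap (𝓞 (K i)) (𝓞 F) x :=
        NumberField.RingOfIntegers.ext (σ.restrictNormal_commutes (K i) (x : K i))
      rw [map_sub, hx]
      exact hσ _
    rw [hP, Subgroup.mem_bot] at hres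
    intro x hx
    have hσx : σ x = x := by
      have := σ.restrictNormal_commutes (K i) ⟨x, hx⟩
      rw [hres] at this
      exact this.symm
    rw [IntermediateField.mem_fixedField_iff]
    intro τ hτ
    have : Subgroup.zpowers σ ≤ MulAction.stabilizer Gal(F/ℚ) x := by
      rw [Subgroup.zpowers_le]; exact hσx
    exact this hτ
  have h : IntermediateField.fixedField (Subgroup.zpowers σ) = ⊤ :=
    top_le_iff.1 (htop ▸ iSup_le hfix)
  rw [Subgroup.mem_bot]
  ext x
  have hx : x ∈ IntermediateField.fixedField (Subgroup.zpowers σ) := h ▸ IntermediateField.mem_top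
  exact (IntermediateField.mem_fixedField_iff _ _).1 hx σ (Subgroup.mem_zpowers σ)

/-- A nontrivial cyclic extension `L` of `ℚ` of prime power degree is totally ramified at some prime.
By Minkowski's theorem some prime ramifies in the subfield of `L` fixed by the largest proper
subgroup `H` of the Galois group, so its inertia groups in `L` are not contained in `H`. -/
theorem NumberField.exists_inertia_eq_top {L : Type*} [Field L] [NumberField L] [IsGalois ℚ L]
    [IsCyclic Gal(L/ℚ)] {p m : ℕ} (hp : p.Prime) (hm : m ≠ 0) (hL : Nat.card Gal(L/ℚ) = p ^ m) :
    ∃ ℓ : ℕ, ℓ.Prime ∧ ∃ Q : Ideal (𝓞 L), Q.IsPrime ∧ Q.LiesOver (Ideal.span {(ℓ : ℤ)}) ∧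
      Q.inertia Gal(L/ℚ) = ⊤ := by
  obtain ⟨H, hH, hmax⟩ := IsCyclic.exists_index_eq_prime_forall_le_or_eq_top hp hm hL
  let M : IntermediateField ℚ L := FixedPoints.intermediateField H
  have hGM : IsGaloisGroup H M L := IsGaloisGroup.subgroup Gal(L/ℚ) ℚ L H
  have hM : Module.finrank ℚ M ≠ 1 := by
    have h1 := Module.finrank_mul_finrank ℚ M L
    rw [← IsGaloisGroup.card_eq_finrank H M L, ← IsGaloisGroup.card_eq_finrank Gal(L/ℚ) ℚ L,
      ← H.card_mul_index, hH] at h1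
    intro h2
    rw [h2, one_mul] at h1
    have := Nat.eq_of_mul_eq_mul_left (Nat.card_pos (α := H)) ((mul_one _).trans h1)
    exact hp.one_lt.ne this
  obtain ⟨ℓ, hℓ, hram⟩ := NumberField.exists_not_isUnramifiedIn (𝒪 := 𝓞 M) hM
  have := Fact.mk hℓ
  rw [Algebra.isUnramifiedIn_iff_forall_of_isDedekindDomain] at hram
  push Not at hram
  obtain ⟨P, _, _, hP⟩ := hram
  obtain ⟨Q, _, _⟩ := (inferInstance : Nonempty (P.primesOver (𝓞 L)))
  have : Q.LiesOver (Ideal.span {(ℓ : ℤ)}) := .trans Q P _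
  refine ⟨ℓ, hℓ, Q, inferInstance, inferInstance, (hmax _).resolve_left fun hle ↦ hP ?_⟩
  rw [← Ideal.ramificationIdx_eq_one_iff]
  have : IsGaloisGroup H (𝓞 M) (𝓞 L) := IsGaloisGroup.of_isFractionRing H (𝓞 M) (𝓞 L) M L
  have hfin : Finite (𝓞 M ⧸ P) := Ideal.finiteQuotientOfFreeOfNeBot P
    (Ideal.ne_bot_of_liesOver_of_ne_bot (p := Ideal.span {(ℓ : ℤ)}) (by simpa using hℓ.ne_zero) P)
  -- The inertia group of `Q` in `H` is all of the inertia group of `Q`, so by multiplicativity of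
  -- ramification indices `P` has ramification index one, contrary to its choice.
  have e1 := NumberField.card_inertia_eq_ramificationIdx hℓ Q
  have e2 := Ideal.card_inertia_eq_ramificationIdxIn (G := H) P Q
  have e3 : Nat.card (Q.inertia H) = Nat.card (Q.inertia Gal(L/ℚ)) :=
    Nat.card_congr (Subgroup.subgroupOfEquivOfLe hle).toEquiv
  rw [Ideal.ramificationIdxIn_eq_ramificationIdx P Q H, e3, e1,
    Ideal.ramificationIdx_tower P Q (R := ℤ)] at e2
  have hpos : 0 < Q.ramificationIdx (𝓞 M) := by
    rw [← Ideal.ramificationIdxIn_eq_ramificationIdx P Q H,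
      ← Ideal.card_inertia_eq_ramificationIdxIn (G := H) P Q]
    exact Nat.card_pos
  exact Nat.eq_of_mul_eq_mul_right hpos (e2.trans (one_mul _).symm)

/-- A cyclic extension of `ℚ` of degree `p ^ m` that is totally and tamely ramified at `ℓ` satisfies
`p ^ m ∣ ℓ - 1`: the residue field at the prime above `ℓ` is the prime field, so the tame inertia bound
is `ℓ - 1`. -/
theorem NumberField.prime_pow_dvd_sub_one_of_inertia_eq_top {L : Type*} [Field L]
    [NumberField L] [IsGalois ℚ L] {p m ℓ : ℕ} [IsCyclic Gal(L/ℚ)]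
    (hL : Nat.card Gal(L/ℚ) = p ^ m) (hℓ : ℓ.Prime) (hpℓ : ¬ ℓ ∣ p) (Q : Ideal (𝓞 L))
    [Q.IsPrime] [Q.LiesOver (Ideal.span {(ℓ : ℤ)})] (hQ : Q.inertia Gal(L/ℚ) = ⊤) : p ^ m ∣ ℓ - 1 := by
  have := Fact.mk hℓ
  have : Finite (ℤ ⧸ Ideal.span {(ℓ : ℤ)}) :=
    Ring.HasFiniteQuotients.finiteQuotient (by simpa using hℓ.ne_zero)
  have hbot : Q ≠ ⊥ :=
    Ideal.ne_bot_of_liesOver_of_ne_bot (p := Ideal.span {(ℓ : ℤ)}) (by simpa using hℓ.ne_zero) Q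
  have : Q.IsMaximal := Ideal.IsPrime.isMaximal inferInstance hbot
  have hfin : Finite (𝓞 L ⧸ Q) := Ideal.finiteQuotientOfFreeOfNeBot Q hbot
  have hf : Q.inertiaDeg ℤ = 1 := by
    have h := Ideal.ncard_primesOver_mul_card_inertia_mul_finrank (G := Gal(L/ℚ))
      (Ideal.span {(ℓ : ℤ)}) Q
    rw [hQ, Subgroup.card_top, mul_right_comm] at h
    exact Nat.eq_one_of_mul_eq_one_left
      (Nat.eq_of_mul_eq_mul_right Nat.card_pos (h.trans (one_mul _).symm))
  have hcard : Nat.card (𝓞 L ⧸ Q) = ℓ := by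
    have := Ideal.pow_inertiaDeg ℓ Q
    rw [hf, pow_one, Ideal.absNorm_apply, Submodule.cardQuot_apply] at this
    exact this.symm
  have : FaithfulSMul Gal(L/ℚ) (𝓞 L) := IsGaloisGroup.faithful ℤ
  obtain ⟨g, hg⟩ := IsCyclic.exists_generator (α := Gal(L/ℚ))
  rw [← hL, ← orderOf_eq_card_of_forall_mem_zpowers hg, ← hcard]
  refine orderOf_dvd_of_pow_eq_one (Ideal.pow_card_quotient_sub_one_eq_one hbot
    (hQ ▸ Subgroup.mem_top g) pow_card_eq_one' ?_)
  rw [hL]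
  intro hmem
  have : ((p ^ m : ℕ) : ℤ) ∈ Ideal.span {(ℓ : ℤ)} := by
    rw [Ideal.LiesOver.over (P := Q) (p := Ideal.span {(ℓ : ℤ)})]
    simpa [Ideal.mem_comap] using hmem
  rw [Ideal.mem_span_singleton, Int.natCast_dvd_natCast] at this
  exact hpℓ (hℓ.dvd_of_dvd_pow this)

/-! ### Subextensions of the maximal extension unramified outside `n` -/

section IntermediateField

variable {k E : Type*} [Field k] [Field E] [Algebra k E]

open IntermediateField

theorem IntermediateField.le_of_adjoin_simple_eq_top {L F : IntermediateField k E} {α : L}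
    (hα : k⟮α⟯ = ⊤) (h : (α : E) ∈ F) : L ≤ F := by
  have hL : L = lift (F := L) k⟮α⟯ := by rw [hα, lift_top]
  rw [hL, lift_adjoin_simple, adjoin_simple_le_iff]
  exact h

theorem IntermediateField.iSup_restrict_eq_top {ι : Type*} {K : ι → IntermediateField k E}
    {F : IntermediateField k E} (hF : F = ⨆ i, K i) (hle : ∀ i, K i ≤ F) :
    ⨆ i, restrict (hle i) = ⊤ := by
  apply lift_injective F
  rw [lift_top]
  refine le_antisymm (lift_le _) ?_
  conv_lhs => rw [hF]
  refine iSup_le fun i ↦ ?_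
  rw [← lift_restrict (hle i)]
  exact map_mono _ (le_iSup (fun i ↦ restrict (hle i)) i)

theorem IntermediateField.exists_surjective_isOpen_ker {K M : IntermediateField k E}
    [FiniteDimensional k K] [hK : Normal k K] [hM : Normal k M] (hle : K ≤ M) :
    ∃ r : Gal(M/k) →* Gal(K/k), Function.Surjective r ∧ IsOpen (r.ker : Set Gal(M/k)) := by
  let e : K ≃ₐ[k] restrict hle := restrictAlgEquiv hle
  have : FiniteDimensional k (restrict hle) := e.toLinearEquiv.finiteDimensional
  have : Normal k (restrict hle) := Normal.of_algEquiv e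
  let r : Gal(M/k) →* Gal(restrict hle/k) := AlgEquiv.restrictNormalHom (restrict hle)
  refine ⟨(AlgEquiv.autCongr e.symm).toMonoidHom.comp r,
    (AlgEquiv.autCongr e.symm).surjective.comp (AlgEquiv.restrictNormalHom_surjective _),
    Subgroup.isOpen_mono (H₁ := r.ker) (fun x hx ↦ ?_) ?_⟩
  · rw [MonoidHom.mem_ker] at hx ⊢
    rw [MonoidHom.comp_apply, hx, map_one]
  · rw [restrictNormalHom_ker]
    exact (restrict hle).fixingSubgroup_isOpen

end IntermediateField

/-- Finite subextensions of the maximal extension unramified outside `n` are unramified outside `n`: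
a primitive element lies in the compositum of finitely many of the defining extensions. -/
theorem UnramifiedOutside.of_le_maxUnramifiedOutside {n : ℕ}
    {L : IntermediateField ℚ (AlgebraicClosure ℚ)} [FiniteDimensional ℚ L]
    (hL : L ≤ maxUnramifiedOutside n) : UnramifiedOutside n L := by
  obtain ⟨α, hα⟩ := Field.exists_primitive_element ℚ L
  obtain ⟨s, hs⟩ := IntermediateField.exists_finset_of_mem_iSup (hL α.2)
  set F : IntermediateField ℚ (AlgebraicClosure ℚ) := ⨆ i ∈ s, i.1 with hF
  have hfd (i : {K : IntermediateField ℚ (AlgebraicClosure ℚ) //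
      FiniteDimensional ℚ K ∧ IsGalois ℚ K ∧ UnramifiedOutside n K}) :
      FiniteDimensional ℚ i.1 := i.2.1
  have hFfd : FiniteDimensional ℚ F := IntermediateField.finiteDimensional_iSup_of_finset
  have hFs : F = ⨆ i : s, i.1.1 := by rw [hF, iSup_subtype']
  have hFgal : IsGalois ℚ F := by
    have (i : s) : Normal ℚ i.1.1 := i.1.2.2.1.to_normal
    have : Normal ℚ F := by
      rw [hFs]; exact IntermediateField.normal_iSup (F := ℚ) (K := AlgebraicClosure ℚ) (h := this)
    exact ⟨⟩
  have hFnf : NumberField F := ⟨⟩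
  have hLnf : NumberField L := ⟨⟩
  have hle (i : s) : i.1.1 ≤ F := hFs ▸ le_iSup (fun i : s ↦ i.1.1) i
  have hLF : L ≤ F := IntermediateField.le_of_adjoin_simple_eq_top hα hs
  have hFunr : UnramifiedOutside n F := by
    have e (i : s) := IntermediateField.restrictAlgEquiv (hle i)
    have hg (i : s) : IsGalois ℚ (IntermediateField.restrict (hle i)) :=
      @IsGalois.of_algEquiv _ _ _ _ _ _ _ _ i.1.2.2.1 (e i)
    refine .of_iSup_eq_top (fun i : s ↦ IntermediateField.restrict (hle i)) (fun i ↦ ?_)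
      (IntermediateField.iSup_restrict_eq_top hFs hle)
    have : NumberField i.1.1 := ⟨⟩
    let _ := (e i).symm.toRingHom.toAlgebra
    exact .of_algebra i.1.2.2.2
  let _ := (IntermediateField.inclusion hLF).toRingHom.toAlgebra
  exact .of_algebra hFunr

theorem mem_piA_of_surjective {n : ℕ} {G : FiniteGrp.{0}}
    (K : IntermediateField ℚ (AlgebraicClosure ℚ)) [FiniteDimensional ℚ K] [IsGalois ℚ K]
    (hK : UnramifiedOutside n K) (f : Gal(K/ℚ) →* G) (hf : Function.Surjective f) : G ∈ piA n := by
  have hle : K ≤ maxUnramifiedOutside n :=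
    le_iSup (fun K : {K : IntermediateField ℚ (AlgebraicClosure ℚ) //
      FiniteDimensional ℚ K ∧ IsGalois ℚ K ∧ UnramifiedOutside n K} ↦ K.1) ⟨K, ‹_›, ‹_›, hK⟩
  have hKn : Normal ℚ K := IsGalois.to_normal
  have : Normal ℚ (maxUnramifiedOutside n) := (maxUnramifiedOutside_isGalois n).to_normal
  obtain ⟨r, hr, hopen⟩ := IntermediateField.exists_surjective_isOpen_ker (hM := this) (hK := hKn) hle
  exact ⟨f.comp r, hf.comp hr, Subgroup.isOpen_mono
    (fun x (hx : r x = 1) ↦ (congrArg f hx).trans (map_one f)) hopen⟩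

/-- Every group in `π_A(U_n)` is the Galois group of a finite Galois extension of `ℚ` unramified
outside `n`, namely of the fixed field of the kernel of a surjection from `π₁(U_n)`. -/
theorem exists_numberField_of_mem_piA {n : ℕ} {G : FiniteGrp.{0}} (hG : G ∈ piA n) :
    ∃ K : IntermediateField ℚ (AlgebraicClosure ℚ), FiniteDimensional ℚ K ∧ IsGalois ℚ K ∧
      UnramifiedOutside n K ∧ Nonempty (Gal(K/ℚ) ≃* G) := by
  obtain ⟨f, hf, hopen⟩ := hG
  let H : ClosedSubgroup (piOne n) := ⟨f.ker, Subgroup.isClosed_of_isOpen _ hopen⟩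
  have hH : H.toSubgroup.Normal := inferInstanceAs f.ker.Normal
  let L := IntermediateField.fixedField H.toSubgroup
  have hfix : L.fixingSubgroup = f.ker := InfiniteGalois.fixingSubgroup_fixedField H
  have hfd : FiniteDimensional ℚ L := (InfiniteGalois.isOpen_iff_finite L).1 (hfix ▸ hopen)
  have hgal : IsGalois ℚ L := (InfiniteGalois.normal_iff_isGalois L).1 (hfix ▸ hH)
  let e : Gal(L/ℚ) ≃* G := (InfiniteGalois.normalAutEquivQuotient H).symm.trans
    (QuotientGroup.quotientKerEquivOfSurjective f hf)
  let e' : L ≃ₐ[ℚ] IntermediateField.lift L := IntermediateField.liftAlgEquiv L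
  have hfd' : FiniteDimensional ℚ (IntermediateField.lift L) := e'.toLinearEquiv.finiteDimensional
  exact ⟨IntermediateField.lift L, hfd', IsGalois.of_algEquiv e',
    .of_le_maxUnramifiedOutside (IntermediateField.lift_le L),
    ⟨(AlgEquiv.autCongr e'.symm).trans e⟩⟩

/-! ### Cyclic `p`-groups in `π_A(U_n)` -/

theorem UnramifiedOutside.of_isCyclotomicExtension {n k : ℕ} [NeZero k] (K : Type*)
    [Field K] [NumberField K] [IsCyclotomicExtension {k} ℚ K] (hk : ∀ q : ℕ, q.Prime → q ∣ k → q ∣ n) :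
    UnramifiedOutside n K := by
  intro q hq hqn Q _ _
  have := Fact.mk hq
  rw [← Ideal.ramificationIdx_eq_one_iff]
  exact IsCyclotomicExtension.Rat.ramificationIdx_eq_of_not_dvd (m := k) q K Q
    fun h ↦ hqn (hk q hq h)

/-- If `p ∣ n`, then `ℤ/p^m` is a quotient of the Galois group of the field of `p^(m+2)`-th roots of
unity, which is unramified outside `p`. -/
theorem cyclicGrp_mem_piA {n p : ℕ} [Fact p.Prime] (hpn : p ∣ n) (m : ℕ) :
    cyclicGrp (p ^ m) ∈ piA n := by
  have hp : p.Prime := Fact.out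
  obtain ⟨ζ, hζ⟩ := HasEnoughRootsOfUnity.exists_primitiveRoot (AlgebraicClosure ℚ) (p ^ (m + 2))
  let K : IntermediateField ℚ (AlgebraicClosure ℚ) := IntermediateField.adjoin ℚ {ζ}
  have halg : Algebra.IsIntegral ℚ (AlgebraicClosure ℚ) :=
    Algebra.isAlgebraic_iff_isIntegral.1 (AlgebraicClosure.isAlgebraic ℚ)
  have hcyc : IsCyclotomicExtension {p ^ (m + 2)} ℚ K :=
    hζ.intermediateField_adjoin_isCyclotomicExtension ℚ
  have hfd : FiniteDimensional ℚ K := IsCyclotomicExtension.finiteDimensional {p ^ (m + 2)} ℚ K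
  have hnf : NumberField K := ⟨⟩
  have hgal : IsGalois ℚ K := IsCyclotomicExtension.isGalois {p ^ (m + 2)} ℚ K
  obtain ⟨f, hf⟩ := ZMod.exists_units_pow_surjective hp m
  exact mem_piA_of_surjective K (.of_isCyclotomicExtension (k := p ^ (m + 2)) K fun q hq h ↦
      (Nat.prime_dvd_prime_iff_eq hq hp).1 (hq.dvd_of_dvd_pow h) ▸ hpn)
    (f.comp (IsCyclotomicExtension.Rat.galEquivZMod (p ^ (m + 2)) K).toMonoidHom)
    (hf.comp (MulEquiv.surjective _))

/-- If `p ∤ n`, a cyclic extension of degree `p ^ m` unramified outside `n` is totally ramified at some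
prime `ℓ ∣ n`. As `ℓ ≠ p`, the ramification is tame, so `p ^ m ∣ ℓ - 1` and `p ^ m < n`. -/
theorem cyclicGrp_pow_notMem_piA {n p : ℕ} [Fact p.Prime] (hn : n ≠ 0) (hpn : ¬ p ∣ n) {m : ℕ}
    (hm : m ≠ 0) (hnm : n ≤ p ^ m) : cyclicGrp (p ^ m) ∉ piA n := by
  have hp : p.Prime := Fact.out
  intro hmem
  obtain ⟨K, hfd, hgal, hunr, ⟨e⟩⟩ := exists_numberField_of_mem_piA hmem
  have hnf : NumberField K := ⟨⟩
  let e' : Gal(K/ℚ) ≃* Multiplicative (ZMod (p ^ m)) := e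
  have hcyc : IsCyclic Gal(K/ℚ) := isCyclic_of_surjective e'.symm e'.symm.surjective
  have hcard : Nat.card Gal(K/ℚ) = p ^ m :=
    (Nat.card_congr e'.toEquiv).trans (Nat.card_zmod _)
  obtain ⟨ℓ, hℓ, Q, _, _, hQ⟩ := NumberField.exists_inertia_eq_top hp hm hcard
  have hℓn : ℓ ∣ n := by
    by_contra hℓn
    have h1 := hunr ℓ hℓ hℓn Q inferInstance inferInstance
    rw [← Ideal.ramificationIdx_eq_one_iff, ← NumberField.card_inertia_eq_ramificationIdx hℓ Q, hQ,
      Subgroup.card_top, hcard] at h1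
    exact (Nat.one_lt_pow hm hp.one_lt).ne' h1
  have hℓp : ¬ ℓ ∣ p := fun h ↦ hpn ((Nat.prime_dvd_prime_iff_eq hℓ hp).1 h ▸ hℓn)
  have hdvd := NumberField.prime_pow_dvd_sub_one_of_inertia_eq_top hcard hℓ hℓp Q hQ
  have h1 := Nat.le_of_dvd (Nat.sub_pos_of_lt hℓ.one_lt) hdvd
  have h2 := Nat.le_of_dvd (Nat.pos_of_ne_zero hn) hℓn
  have := hℓ.pos
  omega

theorem prime_dvd_iff_forall_cyclicGrp_mem_piA {n : ℕ} (hn : n ≠ 0) (p : ℕ) [Fact p.Prime] :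
    p ∣ n ↔ ∀ m : ℕ, cyclicGrp (p ^ m) ∈ piA n := by
  refine ⟨cyclicGrp_mem_piA, fun h ↦ ?_⟩
  by_contra hpn
  exact cyclicGrp_pow_notMem_piA hn hpn hn (Nat.lt_pow_self (Fact.out : p.Prime).one_lt).le (h n)

theorem mainTheorem10 :
    (∀ n : ℕ, Squarefree n → ∀ (p : ℕ) [Fact p.Prime],
      p ∣ n ↔ ∀ m : ℕ, cyclicGrp (p ^ m) ∈ piA n) ∧
    (∀ n₁ n₂ : ℕ, Squarefree n₁ → Squarefree n₂ → n₁ ≠ n₂ → piA n₁ ≠ piA n₂) := by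
  refine ⟨fun n hn p _ ↦ prime_dvd_iff_forall_cyclicGrp_mem_piA hn.ne_zero p,
    fun n₁ n₂ h₁ h₂ hne heq ↦ hne ((Nat.Squarefree.ext_iff h₁ h₂).2 fun p hp ↦ ?_)⟩
  have := Fact.mk hp
  rw [prime_dvd_iff_forall_cyclicGrp_mem_piA h₁.ne_zero,
    prime_dvd_iff_forall_cyclicGrp_mem_piA h₂.ne_zero, heq]
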